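/- For $\omega$ in the upper half-plane let $G_m(\omega)=\sum_{(n_1,n_2)\in\mathbb Z^2\setminus\{(0,0)\}}(n_1\omega+n_2)^{-2m}$ for $m\ge 2$, $g_2=60\,G_2$, $g_3=140\,G_3$, $\Delta=g_2^3-27g_3^2$, and let $j=2^6 3^3 g_2^3/\Delta$ be the absolute invariant. For a positive integer $s$ let $S_1,\dots,S_{\psi(s)}$ be the integer matrices $\begin{pmatrix}a&b\\0&d\end{pmatrix}$ with $a>0$, $ad=s$, $0\le b<d$ and $\gcd(a,b,d)=1$; they act by $S_\nu(\omega)=(a\omega+b)/d$. Then: (1) For every $s\ge 1$ there is a unique polynomial $J_s(X,Y)\in\mathbb Z[X,Y]$ such that for all $\omega$ in the upper half-plane $$J_s(X,j(\omega))=\prod_{\nu=1}^{\psi(s)}\bigl(X-j(S_\nu(\omega))\bigr).$$ (2) For every prime $p$ one has $J_p(X,Y)\equiv (X^p-Y)(X-Y^p) \pmod p$, i.e. all coefficients of the difference are divisible by $p$. -/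

import Mathlib

open Polynomial UpperHalfPlane

namespace ModularTransformation

noncomputable section

/-- The lattice sum `∑ (m ω + n)^(-2k)` over all integer pairs `(m, n) ≠ (0, 0)`. -/
def G (k : ℕ) (ω : ℂ) : ℂ :=
  ∑' v : {v : Fin 2 → ℤ // v ≠ 0}, ((v.1 0 : ℂ) * ω + (v.1 1 : ℂ)) ^ (-(2 * (k : ℤ)))

/-- The Weierstrass invariant `g₂`. -/
def g₂ (ω : ℂ) : ℂ := 60 * G 2 ω

/-- The Weierstrass invariant `g₃`. -/
def g₃ (ω : ℂ) : ℂ := 140 * G 3 ω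

/-- The discriminant of the lattice `ℤ ω + ℤ`. -/
def discr (ω : ℂ) : ℂ := g₂ ω ^ 3 - 27 * g₃ ω ^ 2

/-- The absolute invariant `j` (used only for `Im ω > 0`). -/
def j (ω : ℂ) : ℂ := 2 ^ 6 * 3 ^ 3 * g₂ ω ^ 3 / discr ω

/-- The fractional linear transformation `ω ↦ (a ω + b) / (c ω + d)`. -/
def moebius (S : Matrix (Fin 2) (Fin 2) ℤ) (ω : ℂ) : ℂ :=
  ((S 0 0 : ℂ) * ω + (S 0 1 : ℂ)) / ((S 1 0 : ℂ) * ω + (S 1 1 : ℂ))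

/-- The triangular representatives of the primitive integer matrices of determinant `s`
modulo left multiplication by the modular group: all `(a b; 0 d)` with `a > 0`, `a d = s`,
`0 ≤ b < d` and `gcd (a, b, d) = 1`. -/
def reps (s : ℕ) : Finset (Matrix (Fin 2) (Fin 2) ℤ) :=
  (((s.divisors ×ˢ Finset.range s) ×ˢ s.divisors).filter fun t =>
      t.1.1 * t.2 = s ∧ t.1.2 < t.2 ∧ Nat.gcd (Nat.gcd t.1.1 t.1.2) t.2 = 1).image
    fun t => !![(t.1.1 : ℤ), (t.1.2 : ℤ); 0, (t.2 : ℤ)]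

theorem mem_reps {s : ℕ} (hs : 0 < s) (S : Matrix (Fin 2) (Fin 2) ℤ) :
    S ∈ reps s ↔ S 1 0 = 0 ∧ 0 < S 0 0 ∧ S 0 0 * S 1 1 = s ∧ 0 ≤ S 0 1 ∧ S 0 1 < S 1 1 ∧
      Int.gcd (Int.gcd (S 0 0) (S 0 1)) (S 1 1) = 1 := by
  simp only [reps, Finset.mem_image, Finset.mem_filter, Finset.mem_product, Nat.mem_divisors,
    Finset.mem_range, Prod.exists]
  constructor
  · rintro ⟨a, b, d, ⟨-, h1, h2, h3⟩, rfl⟩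
    have ha : 0 < a := Nat.pos_of_ne_zero (by rintro rfl; simp at h1; omega)
    refine ⟨by simp, by simpa using ha, by simp [← h1], by simp, by simpa using h2, ?_⟩
    simpa using h3
  · rintro ⟨h0, ha, h1, hb, hbd, hg⟩
    obtain ⟨a, ea⟩ := Int.eq_ofNat_of_zero_le ha.le
    obtain ⟨b, eb⟩ := Int.eq_ofNat_of_zero_le hb
    obtain ⟨d, ed⟩ := Int.eq_ofNat_of_zero_le (hb.trans hbd.le)
    rw [ea] at ha
    rw [ea, ed] at h1
    rw [eb, ed] at hbd
    rw [ea, eb, ed] at hg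
    have h1' : a * d = s := by exact_mod_cast h1
    have hbd' : b < d := by exact_mod_cast hbd
    have ha' : 0 < a := by exact_mod_cast ha
    refine ⟨a, b, d, ⟨⟨⟨⟨⟨d, h1'.symm⟩, hs.ne'⟩, ?_⟩, ⟨⟨a, ?_⟩, hs.ne'⟩⟩, h1', hbd', ?_⟩, ?_⟩
    · nlinarith
    · rw [mul_comm, h1']
    · simpa using hg
    · ext i k
      fin_cases i <;> fin_cases k <;> simp [ea, eb, ed, h0]

/-- The principal polynomial `∏_ν (X - j (S_ν ω))` of level `s`, at the point `ω`. -/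
def principalPoly (s : ℕ) (ω : ℂ) : ℂ[X] :=
  ∏ S ∈ reps s, (X - C (j (moebius S ω)))

/-- `F ∈ ℤ[Y][X]` expresses the principal polynomial of level `s` as a polynomial in `X` (the
outer variable) and `Y = j(ω)` (the inner variable): `F(X, j(ω)) = ∏_ν (X - j (S_ν ω))` as
polynomials in `X`, for all `ω` in the upper half-plane. -/
def IsModularPolynomial (s : ℕ) (F : ℤ[X][X]) : Prop :=
  ∀ ω : ℍ, F.map (eval₂RingHom (Int.castRingHom ℂ) (j (ω : ℂ))) = principalPoly s (ω : ℂ)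

end

end ModularTransformation

/-!
The function `q j` has a `q`-expansion with integer coefficients and constant term `1`. Hence an
`SL₂(ℤ)`-invariant function on the upper half-plane whose expansion has coefficients in a ring `R`
and a pole of finite order `M` at infinity is a polynomial in `j` over `R`: subtracting a multiple
of `j ^ M` lowers the order of the pole, and an invariant function without a pole is constant.

The coefficients of the principal polynomial of level `s` are invariant because right
multiplication by `SL₂(ℤ)` permutes the representatives modulo left multiplication. Their
expansions in powers of `q ^ (1 / s)` have coefficients in `ℤ[ζ]`, with `ζ` a primitive `s`-th root
of unity; replacing `ζ` by `ζ ^ u` permutes the factors, so these coefficients are integers, and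
integer powers of `q` suffice because the function has period `1`.

For `s = p` prime, `ζ` becomes `1` modulo a prime above `p`. There `f (X ^ p) = f ^ p`, which turns
the expansion of the principal polynomial into that of `(X ^ p - j) (X - j ^ p)`. The difference
divided by `p` therefore has an integral expansion, so it is again a polynomial over `ℤ` in `j`.
-/

namespace ModularTransformation

noncomputable section

open ModularForm EisensteinSeries MatrixGroups Function.Periodic
open scoped ArithmeticFunction.sigma PowerSeries Manifold Topology

section ConvergentSeries

lemma constantCoeff_powerSeries_map {R S : Type*} [CommRing R] [CommRing S] (φ : R →+* S)
    (f : R⟦X⟧) : (f.map φ).constantCoeff = φ f.constantCoeff :=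
  MvPowerSeries.constantCoeff_map φ f

lemma exists_expand_eq_of_coeff_eq_zero {R : Type*} [CommRing R] {f : R⟦X⟧} {m : ℕ}
    (hm : m ≠ 0) (hf : ∀ n, ¬ m ∣ n → f.coeff n = 0) :
    ∃ g : R⟦X⟧, g.expand m hm = f := by
  refine ⟨PowerSeries.mk fun n => f.coeff (m * n), ?_⟩
  ext n
  by_cases hn : m ∣ n
  · obtain ⟨k, rfl⟩ := hn
    rw [PowerSeries.coeff_expand_mul, PowerSeries.coeff_mk]
  · rw [PowerSeries.coeff_expand_of_not_dvd _ _ _ hn, hf n hn]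

variable {R 𝕜 : Type*} [CommRing R] [RCLike 𝕜] [Algebra R 𝕜] {q : 𝕜}

lemma hasSum_coeff_mul {f g : R⟦X⟧} {u v : 𝕜}
    (hf : HasSum (fun n => algebraMap R 𝕜 (f.coeff n) * q ^ n) u)
    (hg : HasSum (fun n => algebraMap R 𝕜 (g.coeff n) * q ^ n) v) :
    HasSum (fun n => algebraMap R 𝕜 ((f * g).coeff n) * q ^ n) (u * v) := by
  have cauchy_term (n : ℕ) : algebraMap R 𝕜 ((f * g).coeff n) * q ^ n =
      ∑ kl ∈ Finset.HasAntidiagonal.antidiagonal n, algebraMap R 𝕜 (f.coeff kl.1) * q ^ kl.1 *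
        (algebraMap R 𝕜 (g.coeff kl.2) * q ^ kl.2) := by
    rw [PowerSeries.coeff_mul, map_sum, Finset.sum_mul]
    refine Finset.sum_congr rfl fun kl hkl => ?_
    rw [← Finset.HasAntidiagonal.mem_antidiagonal.mp hkl, pow_add, map_mul]
    ring
  have h := summable_norm_sum_mul_antidiagonal_of_summable_norm hf.summable.norm hg.summable.norm
  rw [← hf.tsum_eq, ← hg.tsum_eq, tsum_mul_tsum_eq_tsum_sum_antidiagonal_of_summable_norm
    hf.summable.norm hg.summable.norm]
  simpa only [cauchy_term] using h.of_norm.hasSum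

variable (R q) in
/-- The relation "the power series `f` over `R` converges at `q` to `v`", as the subring of all
such pairs `(f, v)`. It is a relation because a series need not converge at `q`. -/
def seriesGraph : Subring (R⟦X⟧ × 𝕜) where
  carrier := {x | HasSum (fun n => algebraMap R 𝕜 (x.1.coeff n) * q ^ n) x.2}
  mul_mem' := hasSum_coeff_mul
  one_mem' := by
    simpa using hasSum_single (f := fun n => algebraMap R 𝕜 ((1 : R⟦X⟧).coeff n) * q ^ n) 0
      (fun n hn => by simp [PowerSeries.coeff_one, hn])
  add_mem' {x y} hx hy := by
    simpa [add_mul] using HasSum.add (Set.mem_ofPred.mp hx) (Set.mem_ofPred.mp hy)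
  zero_mem' := by simp
  neg_mem' {x} hx := by simpa using HasSum.neg (Set.mem_ofPred.mp hx)

lemma mem_seriesGraph {x : R⟦X⟧ × 𝕜} :
    x ∈ seriesGraph R q ↔ HasSum (fun n => algebraMap R 𝕜 (x.1.coeff n) * q ^ n) x.2 :=
  Iff.rfl

variable (q) in
lemma C_mem_seriesGraph (a : R) : (PowerSeries.C a, algebraMap R 𝕜 a) ∈ seriesGraph R q := by
  simpa [mem_seriesGraph] using
    hasSum_single (f := fun n => algebraMap R 𝕜 ((PowerSeries.C a).coeff n) * q ^ n) 0
      (fun n hn => by simp [PowerSeries.coeff_C, hn])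

variable (R q) in
lemma X_mem_seriesGraph : (PowerSeries.X, q) ∈ seriesGraph R q := by
  simpa [mem_seriesGraph] using
    hasSum_single (f := fun n => algebraMap R 𝕜 ((PowerSeries.X : R⟦X⟧).coeff n) * q ^ n) 1
      (fun n hn => by simp [PowerSeries.coeff_X, hn])

lemma mem_seriesGraph_of_X_mul_mem {f : R⟦X⟧} {v : 𝕜} (hq : q ≠ 0)
    (h : (PowerSeries.X * f, q * v) ∈ seriesGraph R q) : (f, v) ∈ seriesGraph R q := by
  rw [mem_seriesGraph, ← hasSum_nat_add_iff' 1] at h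
  refine (hasSum_mul_left_iff hq).mp ?_
  simpa [PowerSeries.coeff_succ_X_mul, pow_succ', mul_left_comm] using h

lemma mem_seriesGraph_of_C_mul_mem {a : R} (ha : algebraMap R 𝕜 a ≠ 0) {f : R⟦X⟧} {v : 𝕜}
    (h : (PowerSeries.C a * f, algebraMap R 𝕜 a * v) ∈ seriesGraph R q) :
    (f, v) ∈ seriesGraph R q := by
  refine (hasSum_mul_left_iff ha).mp ?_
  simpa [mem_seriesGraph, mul_assoc] using h

lemma map_mem_seriesGraph_iff {S : Type*} [CommRing S] [Algebra S 𝕜] {φ : R →+* S}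
    (hφ : (algebraMap S 𝕜).comp φ = algebraMap R 𝕜) {f : R⟦X⟧} {v : 𝕜} :
    (f.map φ, v) ∈ seriesGraph S q ↔ (f, v) ∈ seriesGraph R q := by
  simp [mem_seriesGraph, ← hφ]

lemma map_algebraMap_mem_seriesGraph {f : R⟦X⟧} {v : 𝕜} (h : (f, v) ∈ seriesGraph R q) :
    (f.map (algebraMap R 𝕜), v) ∈ seriesGraph 𝕜 q :=
  (map_mem_seriesGraph_iff rfl).mpr h

lemma rescale_mem_seriesGraph {f : R⟦X⟧} {v : 𝕜} (w : R)
    (h : (f, v) ∈ seriesGraph R (algebraMap R 𝕜 w * q)) :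
    (PowerSeries.rescale w f, v) ∈ seriesGraph R q := by
  simpa [mem_seriesGraph, PowerSeries.coeff_rescale, mul_pow, mul_left_comm, mul_assoc] using h

lemma expand_mem_seriesGraph_iff {f : R⟦X⟧} {v : 𝕜} {m : ℕ} (hm : m ≠ 0) :
    (f.expand m hm, v) ∈ seriesGraph R q ↔ (f, v) ∈ seriesGraph R (q ^ m) := by
  rw [mem_seriesGraph, ← (mul_right_injective₀ hm).hasSum_iff]
  · simp [mem_seriesGraph, PowerSeries.coeff_expand_mul, Function.comp_def, pow_mul]
  · intro n hn
    rw [PowerSeries.coeff_expand_of_not_dvd _ _ _ fun ⟨k, hk⟩ => hn ⟨k, hk.symm⟩, map_zero,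
      zero_mul]

lemma eq_zero_of_zero_mem_seriesGraph {v : 𝕜} (h : (0, v) ∈ seriesGraph R q) : v = 0 :=
  HasSum.unique h (seriesGraph R q).zero_mem

end ConvergentSeries

section Coeffwise

variable {A B : Type*} [CommRing A] [CommRing B]

/-- The pairs of polynomials whose coefficients are, degree by degree, related by `S`. -/
def coeffwise (S : Subring (A × B)) : Subring (A[X] × B[X]) where
  carrier := {x | ∀ k, (x.1.coeff k, x.2.coeff k) ∈ S}
  mul_mem' {x y} hx hy k := by
    rw [Prod.fst_mul, Prod.snd_mul, coeff_mul, coeff_mul, prod_mk_sum]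
    exact S.sum_mem fun i _ => S.mul_mem (hx i.1) (hy i.2)
  one_mem' k := by
    rw [Prod.fst_one, Prod.snd_one, coeff_one, coeff_one]
    split_ifs
    exacts [S.one_mem, S.zero_mem]
  add_mem' hx hy k := by simpa using! S.add_mem (hx k) (hy k)
  zero_mem' _ := S.zero_mem
  neg_mem' hx k := by simpa using! S.neg_mem (hx k)

variable {S : Subring (A × B)}

lemma mem_coeffwise {x : A[X] × B[X]} :
    x ∈ coeffwise S ↔ ∀ k, (x.1.coeff k, x.2.coeff k) ∈ S := Iff.rfl

lemma C_mem_coeffwise {a : A} {b : B} (h : (a, b) ∈ S) : (C a, C b) ∈ coeffwise S := by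
  intro k
  rw [coeff_C, coeff_C]
  split_ifs
  exacts [h, S.zero_mem]

lemma X_mem_coeffwise : (X, X) ∈ coeffwise S := by
  intro k
  rw [coeff_X, coeff_X]
  split_ifs
  exacts [S.one_mem, S.zero_mem]

end Coeffwise

section QExpansions

lemma mdifferentiable_qParam (h : ℝ) : MDiff (fun τ : ℍ => qParam h τ) := by
  rw [UpperHalfPlane.mdifferentiable_iff]
  refine (differentiable_qParam (h := h)).differentiableOn.congr fun z hz => ?_
  simp [ofComplex_apply_of_im_pos hz]

lemma qParam_vadd (h : ℝ) (x : ℝ) (τ : ℍ) :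
    qParam h ((x +ᵥ τ : ℍ) : ℂ) = qParam h x * qParam h τ := by
  rw [coe_vadd, qParam, qParam, qParam, ← Complex.exp_add]
  ring_nf

lemma qParam_one_vadd_one (τ : ℍ) : qParam 1 (((1 : ℝ) +ᵥ τ : ℍ) : ℂ) = qParam 1 τ := by
  have qParam_one : qParam 1 (1 : ℝ) = 1 := by
    simp [qParam]
  rw [qParam_vadd, qParam_one, one_mul]

lemma cuspFunction_zero_fun (h : ℝ) : UpperHalfPlane.cuspFunction h 0 = 0 := by
  simpa [UpperHalfPlane.cuspFunction, Function.Periodic.cuspFunction]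
    using! (tendsto_const_nhds.mono_left nhdsWithin_le_nhds).limUnder_eq

lemma eq_of_mem_seriesGraph_qParam {R : Type*} [CommRing R] [Algebra R ℂ]
    (hR : Function.Injective (algebraMap R ℂ)) {h : ℝ} (hh : 0 < h) {f g : R⟦X⟧} {c : ℍ → ℂ}
    (hf : ∀ τ : ℍ, (f, c τ) ∈ seriesGraph R (qParam h τ))
    (hg : ∀ τ : ℍ, (g, c τ) ∈ seriesGraph R (qParam h τ)) : f = g := by
  have sum_zero (τ : ℍ) : HasSum
      (fun n => algebraMap R ℂ ((f - g).coeff n) • qParam h τ ^ n) ((0 : ℍ → ℂ) τ) := by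
    simpa [mem_seriesGraph] using (seriesGraph R (qParam h τ)).sub_mem (hf τ) (hg τ)
  have hpower := hasFPowerSeriesOnBall_cuspFunction hh
    (by rw [cuspFunction_zero_fun]; exact analyticAt_const) sum_zero
  rw [cuspFunction_zero_fun] at hpower
  ext n
  have hn := congrArg (fun p => p.coeff n) hpower.hasFPowerSeriesAt.eq_zero
  simp only [FormalMultilinearSeries.coeff_ofScalars] at hn
  exact sub_eq_zero.mp (hR (by rw [map_zero, ← map_sub]; exact hn))

lemma mdifferentiable_of_hasSum_qParam {h : ℝ} (hh : 0 < h) {f : ℍ → ℂ} {c : ℕ → ℂ}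
    (hf : ∀ τ : ℍ, HasSum (fun m => c m * qParam h τ ^ m) (f τ)) : MDiff f := by
  let p : FormalMultilinearSeries ℂ ℂ ℂ := .ofScalars ℂ c
  have one_le_radius : 1 ≤ p.radius := by
    refine le_of_forall_lt_imp_le_of_dense fun r hr => ?_
    rcases eq_or_ne r 0 with rfl | hr'
    · exact zero_le
    · lift r to NNReal using hr.ne_top
      have hr1 : ‖((r : ℝ) : ℂ)‖ < 1 := by simpa using hr
      have hr0 : ((r : ℝ) : ℂ) ≠ 0 := by exact_mod_cast hr'
      apply FormalMultilinearSeries.le_radius_of_summable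
      have := (hf ⟨_, im_invQParam_pos_of_norm_lt_one hh hr1 hr0⟩).summable.norm
      simp only [qParam_right_inv hh.ne' hr0] at this
      simpa [p] using this
  have differentiableOn_sum : DifferentiableOn ℂ p.sum (Metric.ball 0 1) := by
    have := ((p.hasFPowerSeriesOnBall (one_pos.trans_le one_le_radius)).mono one_pos
      one_le_radius).differentiableOn
    rwa [← ENNReal.coe_one, Metric.eball_coe, NNReal.coe_one] at this
  have eq_sum (τ : ℍ) : f τ = p.sum (qParam h τ) := by
    rw [← (hf τ).tsum_eq]
    simp [p, FormalMultilinearSeries.sum, mul_comm]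
  rw [UpperHalfPlane.mdifferentiable_iff]
  refine (differentiableOn_sum.comp (differentiable_qParam (h := h)).differentiableOn
    fun z hz => ?_).congr fun z hz => ?_
  · simpa using norm_qParam_lt_one hh hz
  · simp [ofComplex_apply_of_im_pos hz, eq_sum]

/-- Such a function is a modular form of level one and weight zero. -/
lemma eq_constantCoeff_of_invariant {R : Type*} [CommRing R] [Algebra R ℂ] {c : ℍ → ℂ}
    (hc : ∀ (γ : SL(2, ℤ)) τ, c (γ • τ) = c τ) {f : R⟦X⟧}
    (hf : ∀ τ : ℍ, (f, c τ) ∈ seriesGraph R (qParam 1 τ)) (τ : ℍ) :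
    c τ = algebraMap R ℂ f.constantCoeff := by
  have hslash (γ : SL(2, ℤ)) : c ∣[(0 : ℤ)] γ = c := by
    ext τ
    rw [SL_slash_apply]
    simpa using hc γ τ
  have hsum (τ : ℍ) : HasSum (fun n => algebraMap R ℂ (f.coeff n) * qParam 1 τ ^ n) (c τ) := hf τ
  let F : ModularForm 𝒮ℒ 0 :=
    { toFun := c
      slash_action_eq' := by
        rintro _ ⟨γ, rfl⟩
        exact hslash γ
      holo' := mdifferentiable_of_hasSum_qParam one_pos hsum
      bdd_at_cusps' := by
        intro x hx
        rw [Subgroup.IsArithmetic.isCusp_iff_isCusp_SL2Z] at hx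
        rw [OnePoint.isBoundedAt_iff_forall_SL2Z hx]
        intro γ _
        rw [hslash]
        exact isBoundedAtImInfty_of_hasSum_qExpansion one_pos hsum }
  obtain ⟨b, hb⟩ := ModularFormClass.levelOne_weight_zero_const F
  have eq_b (τ : ℍ) : c τ = b := congrFun hb τ
  have map_f : f.map (algebraMap R ℂ) = PowerSeries.C b :=
    eq_of_mem_seriesGraph_qParam (c := c) Function.injective_id one_pos
      (fun τ => map_algebraMap_mem_seriesGraph (hf τ))
      fun τ => by rw [eq_b]; exact C_mem_seriesGraph (qParam 1 τ) b
  rw [eq_b, ← PowerSeries.coeff_zero_eq_constantCoeff_apply, ← PowerSeries.coeff_map, map_f,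
    PowerSeries.coeff_zero_C]

end QExpansions

section AbsoluteInvariant

lemma G_eq_riemannZeta_mul_E {k : ℕ} (hk : 3 ≤ 2 * k) (τ : ℍ) :
    G k τ = 2 * riemannZeta (2 * k : ℕ) * E hk τ := by
  have tsum_eq_G : ∑' v : Fin 2 → ℤ, eisSummand (2 * k : ℕ) v τ = G k τ := by
    refine (tsum_subtype_eq_of_support_subset (s := {v : Fin 2 → ℤ | v ≠ 0}) ?_).symm.trans ?_
    · rintro v hv rfl
      refine hv ?_
      simp only [eisSummand, Pi.zero_apply, Int.cast_zero, zero_mul, add_zero]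
      exact zero_zpow _ (by omega)
    · exact tsum_congr fun v => by simp [eisSummand]
  rw [← tsum_eq_G, tsum_eisSummand_eq_riemannZeta_mul_eisensteinSeries hk,
    show E hk τ = (1 / 2 : ℂ) • eisensteinSeriesSIF (N := 1) 0 (2 * k : ℕ) τ from rfl,
    eisensteinSeriesSIF_apply, smul_eq_mul]
  ring

lemma riemannZeta_six : riemannZeta 6 = Real.pi ^ 6 / 945 := by
  have h := riemannZeta_two_mul_nat (k := 3) (by norm_num)
  have hb : _root_.bernoulli 6 = 1 / 42 := by decide +kernel
  norm_num [hb, Nat.factorial] at h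
  rw [h]
  ring

lemma j_eq_E₄_cube_div (τ : ℍ) : j τ = E₄ τ ^ 3 / ModularForm.discriminant τ := by
  have g₂_eq : g₂ τ = 60 * (2 * (Real.pi ^ 4 / 90) * E₄ τ) := by
    rw [g₂, G_eq_riemannZeta_mul_E (by norm_num), ← riemannZeta_four]
    norm_num
  have g₃_eq : g₃ τ = 140 * (2 * (Real.pi ^ 6 / 945) * E₆ τ) := by
    rw [g₃, G_eq_riemannZeta_mul_E (by norm_num), ← riemannZeta_six]
    norm_num
  have discr_eq : discr τ = 2 ^ 12 * Real.pi ^ 12 * ModularForm.discriminant τ := by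
    rw [discr, g₂_eq, g₃_eq, discriminant_eq_E₄_cube_sub_E₆_sq τ]
    ring
  have hπ : (Real.pi : ℂ) ≠ 0 := by exact_mod_cast Real.pi_ne_zero
  have hΔ := ModularForm.discriminant_ne_zero τ
  rw [j, discr_eq, g₂_eq]
  field_simp
  ring

lemma apply_smul_eq_denom_zpow_mul {F : Type*} [FunLike F ℍ ℂ] {k : ℤ}
    [SlashInvariantFormClass F 𝒮ℒ k] (f : F) (γ : SL(2, ℤ)) (τ : ℍ) :
    f (γ • τ) = denom γ τ ^ k * f τ := by
  have : SlashInvariantFormClass F (CongruenceSubgroup.Gamma 1) k :=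
    CongruenceSubgroup.Gamma_one_coe_eq_SL ▸ inferInstance
  exact SlashInvariantForm.slash_action_eqn_SL'' f (CongruenceSubgroup.mem_Gamma_one γ) τ

lemma j_smul (γ : SL(2, ℤ)) (τ : ℍ) : j (γ • τ : ℍ) = j τ := by
  have hden : denom γ τ ≠ 0 := denom_ne_zero _ _
  have hΔ := ModularForm.discriminant_ne_zero τ
  simp only [j_eq_E₄_cube_div, ← CuspForm.coe_discriminant] at hΔ ⊢
  rw [apply_smul_eq_denom_zpow_mul E₄, apply_smul_eq_denom_zpow_mul CuspForm.discriminant]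
  field_simp

lemma mdifferentiable_j : MDiff (fun τ : ℍ => j τ) := by
  simp only [j_eq_E₄_cube_div]
  exact (E₄.pow 3).holo'.div CuspForm.discriminant.holo' ModularForm.discriminant_ne_zero

lemma isBoundedAtImInfty_qParam_mul_j : IsBoundedAtImInfty (fun τ : ℍ => qParam 1 τ * j τ) := by
  have qParam_isBigO : (fun τ : ℍ => qParam 1 τ) =O[atImInfty] ModularForm.discriminant := by
    refine Asymptotics.IsBigO.trans (.of_bound 1 (.of_forall fun τ => ?_)) exp_isBigO_discriminant
    simp [norm_qParam]
  have quotient_isBigO : (fun τ : ℍ => qParam 1 τ / ModularForm.discriminant τ) =O[atImInfty]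
      (fun _ => (1 : ℂ)) := by
    refine (qParam_isBigO.mul (Asymptotics.isBigO_refl
      (fun τ => (ModularForm.discriminant τ)⁻¹) atImInfty)).congr (fun τ => ?_) fun τ => ?_
    · rw [div_eq_mul_inv]
    · exact mul_inv_cancel₀ (ModularForm.discriminant_ne_zero τ)
  have E₄_cube_isBigO : (fun τ : ℍ => E₄ τ ^ 3) =O[atImInfty] (fun _ => (1 : ℂ)) := by
    simpa using! (((ModularFormClass.bdd_at_infty E₄).trans
      (Asymptotics.isBigO_const_const (1 : ℝ) (one_ne_zero (α := ℂ)) _)).pow 3)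
  refine ((quotient_isBigO.mul E₄_cube_isBigO).congr (fun τ => ?_) fun _ => rfl).trans
    (Asymptotics.isBigO_const_const _ one_ne_zero _)
  rw [j_eq_E₄_cube_div]
  ring

lemma periodic_comp_ofComplex {f : ℍ → ℂ} {x : ℝ} (hf : ∀ τ, f (x +ᵥ τ) = f τ) :
    Function.Periodic (f ∘ ofComplex) x := by
  intro w
  by_cases! hw : 0 < w.im
  · have hw' : 0 < (w + x).im := by simpa using hw
    have vadd_eq : (⟨w + x, hw'⟩ : ℍ) = x +ᵥ ⟨w, hw⟩ := by
      ext
      exact add_comm w x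
    simp only [Function.comp_apply, ofComplex_apply_of_im_pos hw', ofComplex_apply_of_im_pos hw]
    rw [vadd_eq, hf]
  · have hw' : (w + x).im ≤ 0 := by simpa using hw
    simp only [Function.comp_apply, ofComplex_apply_of_im_nonpos hw',
      ofComplex_apply_of_im_nonpos hw]

lemma qParam_mul_j_mem_seriesGraph_qExpansion (τ : ℍ) :
    (qExpansion 1 (fun τ : ℍ => qParam 1 τ * j τ), qParam 1 τ * j τ) ∈
      seriesGraph ℂ (qParam 1 τ) := by
  refine hasSum_qExpansion one_pos (periodic_comp_ofComplex fun τ => ?_)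
    ((mdifferentiable_qParam 1).mul mdifferentiable_j) isBoundedAtImInfty_qParam_mul_j τ
  simp only [Pi.mul_apply]
  rw [qParam_one_vadd_one, ← modular_T_smul, j_smul]

end AbsoluteInvariant

section IntegralExpansions

/-- The generating series `∑ σ_k(n) qⁿ` of the divisor sums, the building block of the
expansions of Eisenstein series. -/
def sigmaSeries (k : ℕ) : ℤ⟦X⟧ := PowerSeries.mk fun n => (σ k n : ℤ)

/-- The `q`-expansion of `E₄`. -/
def E₄Series : ℤ⟦X⟧ := 1 + PowerSeries.C 240 * sigmaSeries 3

/-- The `q`-expansion of `E₆`. -/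
def E₆Series : ℤ⟦X⟧ := 1 + PowerSeries.C (-504) * sigmaSeries 5

/-- The `q`-expansion of the discriminant `Δ = (E₄³ - E₆²) / 1728`. The first summand is
`(5 ∑ σ₃(n) qⁿ + 7 ∑ σ₅(n) qⁿ) / 12`, the division being exact because `12 ∣ 5 d³ + 7 d⁵`. -/
def discrSeries : ℤ⟦X⟧ :=
  PowerSeries.mk (fun n => ∑ d ∈ n.divisors, (5 * (d : ℤ) ^ 3 + 7 * (d : ℤ) ^ 5) / 12) +
    100 * sigmaSeries 3 ^ 2 + 8000 * sigmaSeries 3 ^ 3 - 147 * sigmaSeries 5 ^ 2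

/-- The `q`-expansion of `Δ / q`. -/
def discrShift : ℤ⟦X⟧ := PowerSeries.mk fun n => discrSeries.coeff (n + 1)

/-- The `q`-expansion of `q j = E₄³ / (Δ / q)`. -/
def jSeries : ℤ⟦X⟧ := E₄Series ^ 3 * PowerSeries.invOfUnit discrShift 1

lemma twelve_dvd_five_mul_cube_add_seven_mul_pow_five (d : ℤ) : 12 ∣ 5 * d ^ 3 + 7 * d ^ 5 := by
  have h : ∀ x : ZMod 12, 5 * x ^ 3 + 7 * x ^ 5 = 0 := by decide
  exact (ZMod.intCast_zmod_eq_zero_iff_dvd _ 12).mp (by exact_mod_cast h d)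

lemma C_mul_discrSeries : PowerSeries.C 1728 * discrSeries = E₄Series ^ 3 - E₆Series ^ 2 := by
  have h : PowerSeries.C 12 * PowerSeries.mk
      (fun n => ∑ d ∈ n.divisors, (5 * (d : ℤ) ^ 3 + 7 * (d : ℤ) ^ 5) / 12) =
      PowerSeries.C 5 * sigmaSeries 3 + PowerSeries.C 7 * sigmaSeries 5 := by
    ext n
    simp only [sigmaSeries, map_add, PowerSeries.coeff_C_mul, PowerSeries.coeff_mk,
      ArithmeticFunction.sigma_apply, Nat.cast_sum, Nat.cast_pow, Finset.mul_sum,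
      ← Finset.sum_add_distrib]
    exact Finset.sum_congr rfl fun d _ =>
      Int.mul_ediv_cancel' (twelve_dvd_five_mul_cube_add_seven_mul_pow_five d)
  simp only [discrSeries, E₄Series, E₆Series, map_neg, map_ofNat] at h ⊢
  linear_combination 144 * h

lemma constantCoeff_sigmaSeries (k : ℕ) : (sigmaSeries k).constantCoeff = 0 := by
  simp [sigmaSeries]

lemma discrSeries_eq_X_mul_discrShift : discrSeries = PowerSeries.X * discrShift := by
  have h0 : discrSeries.constantCoeff = 0 := by
    simp [discrSeries, constantCoeff_sigmaSeries]
  simpa [h0] using! PowerSeries.eq_X_mul_shift_add_const discrSeries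

lemma constantCoeff_discrShift : discrShift.constantCoeff = 1 := by
  rw [← PowerSeries.coeff_zero_eq_constantCoeff_apply, discrShift, PowerSeries.coeff_mk]
  simp [discrSeries, sigmaSeries, PowerSeries.coeff_mul, pow_succ, Finset.Nat.antidiagonal_succ]

lemma jSeries_mul_discrShift : jSeries * discrShift = E₄Series ^ 3 := by
  rw [jSeries, mul_assoc, mul_comm _ discrShift,
    PowerSeries.mul_invOfUnit _ _ (by simpa using constantCoeff_discrShift), mul_one]

lemma constantCoeff_jSeries : jSeries.constantCoeff = 1 := by
  simpa [constantCoeff_discrShift, E₄Series, constantCoeff_sigmaSeries] using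
    congrArg PowerSeries.constantCoeff jSeries_mul_discrShift

variable (τ : ℍ)

lemma one_add_C_mul_sigmaSeries_mem_seriesGraph {k : ℕ} (hk : 3 ≤ k) (hk2 : Even k) {a : ℤ}
    (ha : (a : ℂ) = -(2 * k / _root_.bernoulli k)) :
    (1 + PowerSeries.C a * sigmaSeries (k - 1), E hk τ) ∈ seriesGraph ℤ (qParam 1 τ) := by
  have coeff_eq (n : ℕ) : algebraMap ℤ ℂ ((1 + PowerSeries.C a * sigmaSeries (k - 1)).coeff n) =
      (qExpansion 1 (E hk)).coeff n := by
    rw [E_qExpansion_coeff hk hk2]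
    rcases eq_or_ne n 0 with rfl | hn
    · simp [sigmaSeries]
    · rw [map_add, PowerSeries.coeff_C_mul, PowerSeries.coeff_one, if_neg hn, zero_add, map_mul,
        sigmaSeries, PowerSeries.coeff_mk]
      simp [hn, ha]
  simpa only [mem_seriesGraph, coeff_eq] using
    ModularForm.hasSum_qExpansion (f := E hk) one_pos one_mem_strictPeriods_SL τ

lemma E₄Series_mem_seriesGraph : (E₄Series, E₄ τ) ∈ seriesGraph ℤ (qParam 1 τ) := by
  have hb : _root_.bernoulli 4 = -1 / 30 := by decide +kernel
  exact one_add_C_mul_sigmaSeries_mem_seriesGraph τ _ ⟨2, rfl⟩ (by norm_num [hb])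

lemma E₆Series_mem_seriesGraph : (E₆Series, E₆ τ) ∈ seriesGraph ℤ (qParam 1 τ) := by
  have hb : _root_.bernoulli 6 = 1 / 42 := by decide +kernel
  exact one_add_C_mul_sigmaSeries_mem_seriesGraph τ _ ⟨3, rfl⟩ (by norm_num [hb])

lemma discrShift_mem_seriesGraph :
    (discrShift, ModularForm.discriminant τ / qParam 1 τ) ∈ seriesGraph ℤ (qParam 1 τ) := by
  have hq : qParam 1 τ ≠ 0 := qParam_ne_zero _
  refine mem_seriesGraph_of_X_mul_mem hq ?_
  rw [mul_div_cancel₀ _ hq, ← discrSeries_eq_X_mul_discrShift]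
  refine mem_seriesGraph_of_C_mul_mem (a := 1728) (by norm_num) ?_
  have h := sub_mem (pow_mem (E₄Series_mem_seriesGraph τ) 3)
    (pow_mem (E₆Series_mem_seriesGraph τ) 2)
  rw [Prod.pow_mk, Prod.pow_mk, Prod.mk_sub_mk] at h
  rw [C_mul_discrSeries, discriminant_eq_E₄_cube_sub_E₆_sq]
  convert h using 2
  rw [map_ofNat, mul_div_cancel₀ _ (by norm_num)]

lemma jSeries_mem_seriesGraph : (jSeries, qParam 1 τ * j τ) ∈ seriesGraph ℤ (qParam 1 τ) := by
  set f := qExpansion 1 (fun τ : ℍ => qParam 1 τ * j τ)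
  have mul_eq : f * discrShift.map (algebraMap ℤ ℂ) = (E₄Series ^ 3).map (algebraMap ℤ ℂ) := by
    refine eq_of_mem_seriesGraph_qParam (c := fun τ => E₄ τ ^ 3) Function.injective_id one_pos
      (fun τ => ?_) fun τ => ?_
    · have h := mul_mem (qParam_mul_j_mem_seriesGraph_qExpansion τ)
        (map_algebraMap_mem_seriesGraph (discrShift_mem_seriesGraph τ))
      rw [Prod.mk_mul_mk] at h
      convert h using 2
      have hq : qParam 1 τ ≠ 0 := qParam_ne_zero _
      have hΔ := ModularForm.discriminant_ne_zero τ
      rw [j_eq_E₄_cube_div]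
      field_simp
    · exact map_algebraMap_mem_seriesGraph (pow_mem (E₄Series_mem_seriesGraph τ) 3)
  have shift_ne_zero : discrShift.map (algebraMap ℤ ℂ) ≠ 0 := fun h0 => by
    simpa [constantCoeff_powerSeries_map, constantCoeff_discrShift] using
      congrArg PowerSeries.constantCoeff h0
  have eq_f : jSeries.map (algebraMap ℤ ℂ) = f := by
    refine mul_right_cancel₀ shift_ne_zero ?_
    rw [mul_eq, ← map_mul, jSeries_mul_discrShift]
  rw [← map_mem_seriesGraph_iff (φ := algebraMap ℤ ℂ) rfl, eq_f]
  exact qParam_mul_j_mem_seriesGraph_qExpansion τ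

lemma infinite_range_j : (Set.range fun τ : ℍ => j τ).Infinite := by
  intro hfin
  let factor (v : ℂ) : ℂ⟦X⟧ := jSeries.map (algebraMap ℤ ℂ) - PowerSeries.C v * PowerSeries.X
  have prod_eq_zero : ∏ v ∈ hfin.toFinset, factor v = 0 := by
    refine eq_of_mem_seriesGraph_qParam (c := 0) Function.injective_id one_pos
      (fun τ => ?_) fun τ => zero_mem _
    have factor_mem (v : ℂ) : (factor v, qParam 1 τ * j τ - v * qParam 1 τ) ∈
        seriesGraph ℂ (qParam 1 τ) := by
      have h := sub_mem (map_algebraMap_mem_seriesGraph (jSeries_mem_seriesGraph τ))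
        (mul_mem (C_mem_seriesGraph (qParam 1 τ) v) (X_mem_seriesGraph ℂ (qParam 1 τ)))
      rwa [Prod.mk_mul_mk, Prod.mk_sub_mk] at h
    have prod_apply : ∏ v ∈ hfin.toFinset, (qParam 1 τ * j τ - v * qParam 1 τ) = 0 :=
      Finset.prod_eq_zero (hfin.mem_toFinset.mpr ⟨τ, rfl⟩) (by ring)
    rw [Pi.zero_apply, ← prod_apply, prod_mk_prod]
    exact prod_mem fun v _ => factor_mem v
  obtain ⟨v, -, hv⟩ := Finset.prod_eq_zero_iff.mp prod_eq_zero
  simpa [factor, constantCoeff_powerSeries_map, constantCoeff_jSeries] using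
    congrArg PowerSeries.constantCoeff hv

end IntegralExpansions

section QExpansionPrinciple

variable {R : Type*} [CommRing R] [Algebra R ℂ]

lemma eq_of_aeval_j_eq (hR : Function.Injective (algebraMap R ℂ)) {f g : R[X]}
    (h : ∀ τ : ℍ, aeval (j τ) f = aeval (j τ) g) : f = g := by
  refine map_injective _ hR (eq_of_infinite_eval_eq _ _ (infinite_range_j.mono ?_))
  rintro _ ⟨τ, rfl⟩
  simpa [eval_map_algebraMap] using h τ

theorem exists_eq_aeval_j_of_mem_seriesGraph (M : ℕ) {c : ℍ → ℂ}
    (hc : ∀ (γ : SL(2, ℤ)) τ, c (γ • τ) = c τ) {f : R⟦X⟧}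
    (hf : ∀ τ : ℍ, (f, qParam 1 τ ^ M * c τ) ∈ seriesGraph R (qParam 1 τ)) :
    ∃ g : R[X], ∀ τ : ℍ, c τ = aeval (j τ) g := by
  induction M generalizing c f with
  | zero =>
    refine ⟨C f.constantCoeff, fun τ => ?_⟩
    rw [aeval_C]
    exact eq_constantCoeff_of_invariant hc (by simpa using hf) τ
  | succ M ih =>
    set a := f.constantCoeff
    obtain ⟨f', hf'⟩ : PowerSeries.X ∣
        f - PowerSeries.C a * jSeries.map (algebraMap ℤ R) ^ (M + 1) := by
      simp [PowerSeries.X_dvd_iff, constantCoeff_powerSeries_map, constantCoeff_jSeries, a]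
    have jSeries_mem (τ : ℍ) : (jSeries.map (algebraMap ℤ R), qParam 1 τ * j τ) ∈
        seriesGraph R (qParam 1 τ) :=
      (map_mem_seriesGraph_iff (RingHom.ext_int _ _)).mpr (jSeries_mem_seriesGraph τ)
    obtain ⟨g, hg⟩ := ih (c := fun τ => c τ - algebraMap R ℂ a * j τ ^ (M + 1)) (f := f')
      (fun γ τ => by rw [hc, j_smul]) fun τ => by
        refine mem_seriesGraph_of_X_mul_mem (qParam_ne_zero (h := 1) _) ?_
        rw [← hf']
        have h := sub_mem (hf τ)
          (mul_mem (C_mem_seriesGraph (qParam 1 τ) a) (pow_mem (jSeries_mem τ) (M + 1)))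
        rw [Prod.pow_mk, Prod.mk_mul_mk, Prod.mk_sub_mk] at h
        convert h using 2
        ring
    refine ⟨g + C a * X ^ (M + 1), fun τ => ?_⟩
    rw [map_add, ← hg τ, map_mul, aeval_C, map_pow, aeval_X, sub_add_cancel]

end QExpansionPrinciple

section FractionalExponents

variable {R : Type*} [CommRing R] [Algebra R ℂ] {s N : ℕ}

lemma qParam_pow_natCast (hs : s ≠ 0) (τ : ℂ) : qParam s τ ^ s = qParam 1 τ := by
  rw [qParam, qParam, ← Complex.exp_nat_mul]
  congr 1
  push_cast
  field_simp

lemma exists_mem_seriesGraph_qParam_one (hR : Function.Injective (algebraMap R ℂ)) (hs : s ≠ 0)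
    {c : ℍ → ℂ} (hc : ∀ τ : ℍ, c ((1 : ℝ) +ᵥ τ) = c τ) {f : R⟦X⟧}
    (hf : ∀ τ : ℍ, (f, c τ) ∈ seriesGraph R (qParam s τ)) :
    ∃ g : R⟦X⟧, ∀ τ : ℍ, (g, c τ) ∈ seriesGraph R (qParam 1 τ) := by
  set ζ := qParam s (1 : ℝ) with hζ
  have isPrimitiveRoot_ζ : IsPrimitiveRoot ζ s := by
    convert Complex.isPrimitiveRoot_exp s hs using 1
    simp [hζ, qParam]
  have rescale_eq : PowerSeries.rescale ζ (f.map (algebraMap R ℂ)) = f.map (algebraMap R ℂ) := by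
    refine eq_of_mem_seriesGraph_qParam (h := s) Function.injective_id
      (by exact_mod_cast Nat.pos_of_ne_zero hs) (fun τ => rescale_mem_seriesGraph ζ ?_)
      fun τ => map_algebraMap_mem_seriesGraph (hf τ)
    have h := map_algebraMap_mem_seriesGraph (hf ((1 : ℝ) +ᵥ τ))
    rwa [qParam_vadd, hc] at h
  have coeff_eq_zero (n : ℕ) (hn : ¬ s ∣ n) : f.coeff n = 0 := by
    have h := congrArg (PowerSeries.coeff n) rescale_eq
    rw [PowerSeries.coeff_rescale, PowerSeries.coeff_map, mul_left_eq_self₀] at h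
    exact (map_eq_zero_iff _ hR).mp
      (h.resolve_left fun h1 => hn (isPrimitiveRoot_ζ.dvd_of_pow_eq_one n h1))
  obtain ⟨g, rfl⟩ := exists_expand_eq_of_coeff_eq_zero hs coeff_eq_zero
  refine ⟨g, fun τ => ?_⟩
  rw [← qParam_pow_natCast hs]
  exact (expand_mem_seriesGraph_iff hs).mp (hf τ)

theorem exists_eq_aeval_j_of_mem_seriesGraph_qParam (hR : Function.Injective (algebraMap R ℂ))
    (hs : s ≠ 0) {c : ℍ → ℂ} (hc : ∀ (γ : SL(2, ℤ)) τ, c (γ • τ) = c τ) {f : R⟦X⟧}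
    (hf : ∀ τ : ℍ, (f, qParam s τ ^ N * c τ) ∈ seriesGraph R (qParam s τ)) :
    ∃ g : R[X], ∀ τ : ℍ, c τ = aeval (j τ) g := by
  obtain ⟨g, hg⟩ := exists_mem_seriesGraph_qParam_one hR hs
    (c := fun τ => qParam 1 τ ^ N * c τ) (f := PowerSeries.X ^ ((s - 1) * N) * f)
    (fun τ => by rw [qParam_one_vadd_one, ← modular_T_smul, hc]) fun τ => by
      have h := mul_mem (pow_mem (X_mem_seriesGraph R (qParam s τ)) ((s - 1) * N)) (hf τ)
      rw [Prod.pow_mk, Prod.mk_mul_mk, ← mul_assoc, ← pow_add, ← add_one_mul,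
        Nat.sub_one_add_one hs, pow_mul (qParam s τ),
        qParam_pow_natCast hs] at h
      exact h
  exact exists_eq_aeval_j_of_mem_seriesGraph N hc hg

theorem exists_map_eval₂_j_eq_of_mem_coeffwise (hR : Function.Injective (algebraMap R ℂ))
    (hs : s ≠ 0) {c : ℍ → ℂ[X]} (hc : ∀ (γ : SL(2, ℤ)) τ, c (γ • τ) = c τ) {P : R⟦X⟧[X]}
    (hP : ∀ τ : ℍ, (P, C (qParam s τ ^ N) * c τ) ∈ coeffwise (seriesGraph R (qParam s τ))) :
    ∃ F : R[X][X], ∀ τ : ℍ, F.map (eval₂RingHom (algebraMap R ℂ) (j τ)) = c τ := by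
  have coeff_mem (k : ℕ) (τ : ℍ) : (P.coeff k, qParam s τ ^ N * (c τ).coeff k) ∈
      seriesGraph R (qParam s τ) := by
    simpa only [coeff_C_mul] using hP τ k
  choose g hg using fun k => exists_eq_aeval_j_of_mem_seriesGraph_qParam hR hs
    (c := fun τ => (c τ).coeff k) (fun γ τ => by rw [hc]) (coeff_mem k)
  refine ⟨∑ k ∈ Finset.range (P.natDegree + 1), monomial k (g k), fun τ => ?_⟩
  ext k
  rw [coeff_map, finsetSum_coeff]
  simp only [coeff_monomial, Finset.sum_ite_eq', Finset.mem_range]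
  split_ifs with hk
  · rw [hg, aeval_def, coe_eval₂RingHom]
  · have h := coeff_mem k τ
    rw [coeff_eq_zero_of_natDegree_lt (by omega)] at h
    rw [map_zero, (mul_eq_zero.mp (eq_zero_of_zero_mem_seriesGraph h)).resolve_left
      (pow_ne_zero _ (qParam_ne_zero _))]

theorem eq_of_map_eval₂_j_eq (hR : Function.Injective (algebraMap R ℂ)) {F G : R[X][X]}
    (h : ∀ τ : ℍ, F.map (eval₂RingHom (algebraMap R ℂ) (j τ)) =
      G.map (eval₂RingHom (algebraMap R ℂ) (j τ))) : F = G := by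
  ext1 k
  refine eq_of_aeval_j_eq hR fun τ => ?_
  simpa only [coeff_map, coe_eval₂RingHom, aeval_def] using congrArg (coeff · k) (h τ)

end FractionalExponents

section PrimitiveMatrices

/-- A matrix is primitive if its entries have no common divisor other than units. For the upper
triangular matrices defining `reps` this is the condition `gcd (a, b, d) = 1`; unlike the latter it
is visibly stable under multiplication by unimodular matrices. -/
def IsPrimitiveMatrix {m n R : Type*} [CommRing R] (M : Matrix m n R) : Prop :=
  ∀ a : R, (∀ i k, a ∣ M i k) → IsUnit a

variable {l m n R : Type*} [Fintype m] [CommRing R] {A : Matrix l m R} {B : Matrix m n R}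

lemma IsPrimitiveMatrix.of_mul_left (h : IsPrimitiveMatrix (A * B)) : IsPrimitiveMatrix B :=
  fun a ha => h a fun _ _ => Finset.dvd_sum fun _ _ => (ha _ _).mul_left _

lemma IsPrimitiveMatrix.of_mul_right (h : IsPrimitiveMatrix (A * B)) : IsPrimitiveMatrix A :=
  fun a ha => h a fun _ _ => Finset.dvd_sum fun _ _ => (ha _ _).mul_right _

lemma isPrimitiveMatrix_iff_gcd_eq_one {S : Matrix (Fin 2) (Fin 2) ℤ} (h0 : S 1 0 = 0) :
    IsPrimitiveMatrix S ↔ Int.gcd (Int.gcd (S 0 0) (S 0 1)) (S 1 1) = 1 := by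
  have dvd_gcd_iff (a : ℤ) :
      (∀ i k, a ∣ S i k) ↔ a ∣ (Int.gcd (Int.gcd (S 0 0) (S 0 1)) (S 1 1) : ℤ) := by
    simp [Fin.forall_fin_two, h0, Int.dvd_coe_gcd_iff, and_assoc]
  simp only [IsPrimitiveMatrix, dvd_gcd_iff]
  refine ⟨fun h => by simpa [Int.isUnit_iff] using h _ dvd_rfl, fun h a ha => ?_⟩
  rw [h] at ha
  exact isUnit_of_dvd_one (by exact_mod_cast ha)

end PrimitiveMatrices

section Representatives

variable {s : ℕ} {S S' T : Matrix (Fin 2) (Fin 2) ℤ}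

lemma exists_smul_eq_of_det_ne_zero {m : ℤ} (hm : m ≠ 0) (A : FixedDetMatrix (Fin 2) ℤ m) :
    ∃ B ∈ FixedDetMatrices.reps m, ∃ γ : SL(2, ℤ), γ • B = A := by
  induction A using FixedDetMatrices.induction_on hm with
  | h0 A h₁ h₂ h₃ h₄ => exact ⟨A, ⟨h₁, h₂, h₃, h₄⟩, 1, one_smul _ A⟩
  | hS A ih =>
    obtain ⟨B, hB, γ, rfl⟩ := ih
    exact ⟨B, hB, ModularGroup.S * γ, mul_smul _ _ _⟩
  | hT A ih =>
    obtain ⟨B, hB, γ, rfl⟩ := ih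
    exact ⟨B, hB, ModularGroup.T * γ, mul_smul _ _ _⟩

lemma det_of_mem_reps (hs : 0 < s) (hS : S ∈ reps s) : S.det = s := by
  obtain ⟨h0, -, had, -⟩ := (mem_reps hs S).mp hS
  rw [Matrix.det_fin_two, h0, had, mul_zero, sub_zero]

lemma isPrimitiveMatrix_of_mem_reps (hs : 0 < s) (hS : S ∈ reps s) : IsPrimitiveMatrix S := by
  obtain ⟨h0, -, -, -, -, hgcd⟩ := (mem_reps hs S).mp hS
  exact (isPrimitiveMatrix_iff_gcd_eq_one h0).mpr hgcd

lemma exists_mul_eq_of_isPrimitiveMatrix (hs : 0 < s) {M : Matrix (Fin 2) (Fin 2) ℤ}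
    (hdet : M.det = s) (hM : IsPrimitiveMatrix M) :
    ∃ S ∈ reps s, ∃ γ : SL(2, ℤ), (γ : Matrix (Fin 2) (Fin 2) ℤ) * S = M := by
  have hs' : (0 : ℤ) < s := by exact_mod_cast hs
  obtain ⟨⟨S, det_S⟩, hS, γ, hγ⟩ := exists_smul_eq_of_det_ne_zero hs'.ne' ⟨M, hdet⟩
  obtain ⟨h0, ha, hb, hbd⟩ : S 1 0 = 0 ∧ 0 < S 0 0 ∧ 0 ≤ S 0 1 ∧ |S 0 1| < |S 1 1| := hS
  obtain rfl : (γ : Matrix (Fin 2) (Fin 2) ℤ) * S = M := congrArg Subtype.val hγ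
  rw [Matrix.det_fin_two, h0, mul_zero, sub_zero] at det_S
  have hd : 0 < S 1 1 := (pos_iff_pos_of_mul_pos (det_S ▸ hs')).mp ha
  rw [abs_of_nonneg hb, abs_of_pos hd] at hbd
  exact ⟨S, (mem_reps hs S).mpr ⟨h0, ha, det_S, hb, hbd,
    (isPrimitiveMatrix_iff_gcd_eq_one h0).mp hM.of_mul_left⟩, γ, rfl⟩

lemma eq_of_mul_eq_of_mem_reps (hs : 0 < s) (hS : S ∈ reps s) (hS' : S' ∈ reps s)
    {γ : SL(2, ℤ)} (h : γ * S = S') : S' = S := by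
  obtain ⟨h0, ha, -, hb, hbd, -⟩ := (mem_reps hs S).mp hS
  obtain ⟨h0', ha', -, hb', hbd', -⟩ := (mem_reps hs S').mp hS'
  have entry (i k : Fin 2) : S' i k = γ i 0 * S 0 k + γ i 1 * S 1 k := by
    rw [← h, Matrix.mul_apply, Fin.sum_univ_two]
  have γ₁₀ : γ 1 0 = 0 := by
    have h₁₀ := entry 1 0
    rw [h0, h0', mul_zero, add_zero, eq_comm] at h₁₀
    exact (mul_eq_zero.mp h₁₀).resolve_right ha.ne'
  have γ₀₀_mul_γ₁₁ : γ 0 0 * γ 1 1 = 1 := by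
    have hdet := γ.det_coe
    rwa [Matrix.det_fin_two, γ₁₀, mul_zero, sub_zero] at hdet
  have γ₀₀_pos : 0 < γ 0 0 := by
    have h₀₀ := entry 0 0
    rw [h0, mul_zero, add_zero] at h₀₀
    exact pos_of_mul_pos_left (h₀₀ ▸ ha') ha.le
  have γ₀₀ : γ 0 0 = 1 := Int.eq_one_of_mul_eq_one_right γ₀₀_pos.le γ₀₀_mul_γ₁₁
  have γ₁₁ : γ 1 1 = 1 := by rwa [γ₀₀, one_mul] at γ₀₀_mul_γ₁₁
  have h₁₁ : S' 1 1 = S 1 1 := by rw [entry, γ₁₀, γ₁₁, zero_mul, zero_add, one_mul]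
  have h₀₁ : S' 0 1 = S 0 1 := by
    rw [← Int.emod_eq_of_lt hb hbd, ← Int.emod_eq_of_lt hb' hbd', h₁₁, entry, γ₀₀, one_mul,
      Int.add_mul_emod_self_right]
  ext i k
  fin_cases i <;> fin_cases k
  · simp [entry, γ₀₀, h0]
  · exact h₀₁
  · exact h0'.trans h0.symm
  · exact h₁₁

lemma exists_mul_eq_mul_of_mem_reps (hs : 0 < s) (hS : S ∈ reps s) (γ : SL(2, ℤ)) :
    ∃ S' ∈ reps s, ∃ δ : SL(2, ℤ), (δ : Matrix (Fin 2) (Fin 2) ℤ) * S' = S * γ := by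
  refine exists_mul_eq_of_isPrimitiveMatrix hs ?_
    (.of_mul_right (B := ((γ⁻¹ : SL(2, ℤ)) : Matrix (Fin 2) (Fin 2) ℤ)) ?_)
  · rw [Matrix.det_mul, γ.det_coe, mul_one, det_of_mem_reps hs hS]
  · rw [mul_assoc, ← Matrix.SpecialLinearGroup.coe_mul, mul_inv_cancel,
      Matrix.SpecialLinearGroup.coe_one, mul_one]
    exact isPrimitiveMatrix_of_mem_reps hs hS

lemma eq_of_mul_eq_mul_of_mem_reps (hs : 0 < s) (hS : S ∈ reps s) (hT : T ∈ reps s)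
    {γ δ ε : SL(2, ℤ)} (hδ : δ * S' = S * γ) (hε : ε * S' = T * γ) : S = T := by
  refine eq_of_mul_eq_of_mem_reps hs hT hS (γ := δ * ε⁻¹) ?_
  have mul_inv_γ (M : Matrix (Fin 2) (Fin 2) ℤ) : M * γ * (γ⁻¹ : SL(2, ℤ)) = M := by
    rw [mul_assoc, ← Matrix.SpecialLinearGroup.coe_mul, mul_inv_cancel,
      Matrix.SpecialLinearGroup.coe_one, mul_one]
  have inv_ε_mul (M : Matrix (Fin 2) (Fin 2) ℤ) : (ε⁻¹ : SL(2, ℤ)) * (ε * M) = M := by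
    rw [← mul_assoc, ← Matrix.SpecialLinearGroup.coe_mul, inv_mul_cancel,
      Matrix.SpecialLinearGroup.coe_one, one_mul]
  rw [← mul_inv_γ S, ← mul_inv_γ T, ← hδ, ← hε, Matrix.SpecialLinearGroup.coe_mul]
  simp only [mul_assoc, inv_ε_mul]

end Representatives

section InvarianceOfPrincipalPoly

variable {s : ℕ} {S : Matrix (Fin 2) (Fin 2) ℤ}

lemma moebius_mul (A : Matrix (Fin 2) (Fin 2) ℤ) {B : Matrix (Fin 2) (Fin 2) ℤ} {ω : ℂ}
    (h : (B 1 0 : ℂ) * ω + B 1 1 ≠ 0) : moebius (A * B) ω = moebius A (moebius B ω) := by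
  simp only [moebius, Matrix.mul_apply, Fin.sum_univ_two, Int.cast_add, Int.cast_mul]
  field_simp
  ring_nf

lemma coe_smul_eq_moebius (γ : SL(2, ℤ)) (τ : ℍ) : ((γ • τ : ℍ) : ℂ) = moebius γ τ := by
  rw [coe_specialLinearGroup_apply]
  simp [moebius]

lemma moebius_coe_smul (S : Matrix (Fin 2) (Fin 2) ℤ) (γ : SL(2, ℤ)) (τ : ℍ) :
    moebius S (γ • τ : ℍ) = moebius (S * γ) τ := by
  rw [coe_smul_eq_moebius, moebius_mul]
  simpa [denom] using denom_ne_zero γ τ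

lemma exists_coe_eq_moebius (hs : 0 < s) (hS : S ∈ reps s) (τ : ℍ) :
    ∃ τ' : ℍ, (τ' : ℂ) = moebius S τ := by
  obtain ⟨h0, ha, -, hb, hbd, -⟩ := (mem_reps hs S).mp hS
  have ha' : (0 : ℝ) < S 0 0 := by exact_mod_cast ha
  have hd' : (0 : ℝ) < S 1 1 := by exact_mod_cast hb.trans_lt hbd
  have im_eq : (moebius S τ).im = S 0 0 * τ.im / S 1 1 := by
    simp [moebius, h0, Complex.div_intCast_im]
  exact ⟨⟨moebius S τ, im_eq ▸ div_pos (mul_pos ha' τ.im_pos) hd'⟩, rfl⟩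

lemma j_moebius_mul_left (hs : 0 < s) (hS : S ∈ reps s) (γ : SL(2, ℤ)) (τ : ℍ) :
    j (moebius (γ * S) τ) = j (moebius S τ) := by
  obtain ⟨h0, -, -, hb, hbd, -⟩ := (mem_reps hs S).mp hS
  obtain ⟨τ', hτ'⟩ := exists_coe_eq_moebius hs hS τ
  have hd : S 1 1 ≠ 0 := (hb.trans_lt hbd).ne'
  rw [moebius_mul _ (by simpa [h0] using hd), ← hτ', ← coe_smul_eq_moebius, j_smul]

theorem principalPoly_smul (hs : 0 < s) (γ : SL(2, ℤ)) (τ : ℍ) :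
    principalPoly s (γ • τ : ℍ) = principalPoly s τ := by
  choose! f f_mem δ δ_mul using fun S hS => exists_mul_eq_mul_of_mem_reps (S := S) hs hS γ
  have f_injOn : Set.InjOn f (reps s) := fun S hS T hT hST =>
    eq_of_mul_eq_mul_of_mem_reps hs hS hT (δ_mul S hS) (hST ▸ δ_mul T hT)
  have f_bijOn : Set.BijOn f (reps s) (reps s) :=
    ((reps s).finite_toSet.injOn_iff_bijOn_of_mapsTo f_mem).mp f_injOn
  refine Finset.prod_nbij f f_mem f_injOn f_bijOn.surjOn fun S hS => ?_
  rw [moebius_coe_smul, ← δ_mul S hS, j_moebius_mul_left hs (f_mem S hS)]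

end InvarianceOfPrincipalPoly

section RootsOfUnity

lemma exists_cyclotomic_dvd_sub_C {K : Type*} [CommRing K] [IsDomain K] [CharZero K] {s : ℕ}
    (hs : 0 < s) {ζ : K} (hζ : IsPrimitiveRoot ζ s) {h : ℤ[X]}
    (hh : ∀ z : K, IsPrimitiveRoot z s → aeval z h = aeval ζ h) :
    ∃ m : ℤ, cyclotomic s ℤ ∣ h - C m := by
  set r := h %ₘ cyclotomic s ℤ
  have degree_r : r.degree < s.totient := by
    simpa only [degree_cyclotomic] using degree_modByMonic_lt h (cyclotomic.monic s ℤ)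
  have aeval_r {z : K} (hz : IsPrimitiveRoot z s) : aeval z r = aeval ζ h := by
    have root : aeval z (cyclotomic s ℤ) = 0 := by
      rw [aeval_def, eval₂_eq_eval_map, map_cyclotomic]
      exact hz.isRoot_cyclotomic hs
    rw [← hh z hz, ← modByMonic_add_div h (cyclotomic s ℤ), map_add, map_mul, root, zero_mul,
      add_zero]
  have map_r : r.map (Int.castRingHom K) = C (aeval ζ h) := by
    refine eq_of_degrees_lt_of_eval_finset_eq (primitiveRoots s K) ?_ ?_ fun z hz => ?_
    · rw [hζ.card_primitiveRoots]
      exact degree_map_le.trans_lt degree_r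
    · rw [hζ.card_primitiveRoots]
      exact degree_C_le.trans_lt (by exact_mod_cast Nat.totient_pos.mpr hs)
    · rw [eval_C, ← aeval_r ((mem_primitiveRoots hs).mp hz), aeval_def, eval₂_eq_eval_map]
      rfl
  have r_eq_C : r = C (r.coeff 0) := by
    refine map_injective (Int.castRingHom K) Int.cast_injective ?_
    rw [map_C, ← coeff_map, map_r, coeff_C_zero]
  refine ⟨r.coeff 0, h /ₘ cyclotomic s ℤ, ?_⟩
  rw [← r_eq_C]
  linear_combination -modByMonic_add_div h (cyclotomic s ℤ)

end RootsOfUnity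

section FormalPrincipalPoly

variable {s : ℕ}

/-- The triples `((a, b), d)` of natural numbers for which `(a b; 0 d)` lies in `reps s`. -/
def repTriples (s : ℕ) : Finset ((ℕ × ℕ) × ℕ) :=
  ((s.divisors ×ˢ Finset.range s) ×ˢ s.divisors).filter fun t =>
    t.1.1 * t.2 = s ∧ t.1.2 < t.2 ∧ Nat.gcd (Nat.gcd t.1.1 t.1.2) t.2 = 1

lemma mem_repTriples (hs : 0 < s) {t : (ℕ × ℕ) × ℕ} : t ∈ repTriples s ↔
    t.1.1 * t.2 = s ∧ t.1.2 < t.2 ∧ Nat.gcd (Nat.gcd t.1.1 t.1.2) t.2 = 1 := by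
  simp only [repTriples, Finset.mem_filter, Finset.mem_product, Nat.mem_divisors, Finset.mem_range,
    and_iff_right_iff_imp]
  rintro ⟨had, hbd, -⟩
  have hd : t.2 ∣ s := Dvd.intro_left _ had
  exact ⟨⟨⟨Dvd.intro _ had, hs.ne'⟩, hbd.trans_le (Nat.le_of_dvd hs hd)⟩, hd, hs.ne'⟩

lemma mem_reps_of_mem_repTriples {t : (ℕ × ℕ) × ℕ} (ht : t ∈ repTriples s) :
    !![(t.1.1 : ℤ), (t.1.2 : ℤ); 0, (t.2 : ℤ)] ∈ reps s :=
  Finset.mem_image_of_mem _ ht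

lemma prod_reps {M : Type*} [CommMonoid M] (s : ℕ) (φ : Matrix (Fin 2) (Fin 2) ℤ → M) :
    ∏ S ∈ reps s, φ S = ∏ t ∈ repTriples s, φ !![(t.1.1 : ℤ), (t.1.2 : ℤ); 0, (t.2 : ℤ)] := by
  refine Finset.prod_image fun t _ t' _ h => ?_
  have h₀₀ := congrFun₂ h 0 0
  have h₀₁ := congrFun₂ h 0 1
  have h₁₁ := congrFun₂ h 1 1
  simp only [Matrix.of_apply, Matrix.cons_val', Matrix.cons_val_zero, Matrix.cons_val_one,
    Nat.cast_inj] at h₀₀ h₀₁ h₁₁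
  exact Prod.ext (Prod.ext h₀₀ h₀₁) h₁₁

variable {R S : Type*} [CommRing R] [CommRing S]

/-- The expansion of `Q ^ m * (X - j τ')` in powers of `Q` at a point `τ'` with
`qParam 1 τ' = w * Q ^ m` and `w ^ s = 1`, so that `w ^ (s - 1)` stands for `w⁻¹`. -/
def formalFactor (s m : ℕ) (w : R) : R⟦X⟧[X] :=
  C (PowerSeries.X ^ m) * X - C (PowerSeries.C (w ^ (s - 1)) *
    (PowerSeries.rescale w (jSeries.map (Int.castRingHom R))).subst
      (PowerSeries.X ^ m : R⟦X⟧))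

/-- The expansion of the principal polynomial of level `s` in powers of `Q = q ^ (1 / s)`,
multiplied by a power of `Q` to clear denominators, over any ring with an `s`-th root of unity `z`
in place of `exp (2 * π * I / s)`. -/
def formalPrincipalPoly (s : ℕ) (z : R) : R⟦X⟧[X] :=
  ∏ t ∈ repTriples s, formalFactor s (t.1.1 ^ 2) (z ^ (t.1.1 * t.1.2))

lemma formalFactor_eq_expand {m : ℕ} (hm : m ≠ 0) (s : ℕ) (w : R) :
    formalFactor s m w = C (PowerSeries.X ^ m) * X - C (PowerSeries.C (w ^ (s - 1)) *
      (PowerSeries.rescale w (jSeries.map (Int.castRingHom R))).expand m hm) := by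
  rw [formalFactor, PowerSeries.expand_apply]

lemma map_formalFactor {m : ℕ} (hm : m ≠ 0) (φ : R →+* S) (s : ℕ) (w : R) :
    (formalFactor s m w).map (PowerSeries.map φ) = formalFactor s m (φ w) := by
  have map_rescale : (PowerSeries.rescale w (jSeries.map (Int.castRingHom R))).map φ =
      PowerSeries.rescale (φ w) (jSeries.map (Int.castRingHom S)) := by
    ext n
    simp [PowerSeries.coeff_rescale]
  simp [formalFactor_eq_expand hm, PowerSeries.map_expand, map_rescale]

lemma map_formalPrincipalPoly (hs : 0 < s) (φ : R →+* S) (z : R) :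
    (formalPrincipalPoly s z).map (PowerSeries.map φ) = formalPrincipalPoly s (φ z) := by
  rw [formalPrincipalPoly, Polynomial.map_prod]
  refine Finset.prod_congr rfl fun t ht => ?_
  have ha : t.1.1 ^ 2 ≠ 0 :=
    pow_ne_zero 2 (Nat.pos_of_mul_pos_right (((mem_repTriples hs).mp ht).1 ▸ hs)).ne'
  rw [map_formalFactor ha, map_pow]

end FormalPrincipalPoly

section GaloisInvariance

variable {s u : ℕ}

lemma mul_mod_mem_repTriples (hs : 0 < s) (hu : u.Coprime s) {t : (ℕ × ℕ) × ℕ}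
    (ht : t ∈ repTriples s) : ((t.1.1, u * t.1.2 % t.2), t.2) ∈ repTriples s := by
  obtain ⟨had, hbd, hgcd⟩ := (mem_repTriples hs).mp ht
  refine (mem_repTriples hs).mpr ⟨had, Nat.mod_lt _ (by omega), ?_⟩
  have coprime_u_d : u.Coprime t.2 := hu.coprime_dvd_right (Dvd.intro_left _ had)
  change ((t.1.1.gcd (u * t.1.2 % t.2)).gcd t.2) = 1
  rw [Nat.gcd_assoc, ← Nat.gcd_rec, coprime_u_d.gcd_mul_left_cancel_right, Nat.gcd_comm t.2,
    ← Nat.gcd_assoc, hgcd]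

lemma injOn_mul_mod_repTriples (hs : 0 < s) (hu : u.Coprime s) :
    Set.InjOn (fun t : (ℕ × ℕ) × ℕ => ((t.1.1, u * t.1.2 % t.2), t.2)) (repTriples s) := by
  rintro ⟨⟨a, b⟩, d⟩ ht ⟨⟨a', b'⟩, d'⟩ ht' h
  obtain ⟨had, hbd, -⟩ := (mem_repTriples hs).mp ht
  obtain ⟨-, hbd', -⟩ := (mem_repTriples hs).mp ht'
  simp only [Prod.mk.injEq] at h
  obtain ⟨⟨rfl, hmod⟩, rfl⟩ := h
  have coprime_d_u : d.gcd u = 1 := (hu.coprime_dvd_right (Dvd.intro_left _ had)).symm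
  rw [Nat.ModEq.eq_of_lt_of_lt (Nat.ModEq.cancel_left_of_coprime coprime_d_u hmod) hbd hbd']

theorem formalPrincipalPoly_pow_of_coprime {R : Type*} [CommRing R] (hs : 0 < s)
    (hu : u.Coprime s) {z : R} (hz : z ^ s = 1) :
    formalPrincipalPoly s (z ^ u) = formalPrincipalPoly s z := by
  have injOn := injOn_mul_mod_repTriples hs hu
  have bijOn := ((repTriples s).finite_toSet.injOn_iff_bijOn_of_mapsTo
    fun t ht => mul_mod_mem_repTriples hs hu ht).mp injOn
  refine Finset.prod_nbij (fun t => ((t.1.1, u * t.1.2 % t.2), t.2))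
    (fun t => mul_mod_mem_repTriples hs hu) injOn bijOn.surjOn ?_
  rintro ⟨⟨a, b⟩, d⟩ ht
  have had : a * d = s := ((mem_repTriples hs).mp ht).1
  have pow_eq : z ^ (u * (a * b)) = z ^ (a * (u * b % d)) := by
    rw [pow_eq_pow_mod _ hz, ← had, mul_left_comm, Nat.mul_mod_mul_left]
  rw [← pow_mul, pow_eq]

end GaloisInvariance

section ExpansionOfPrincipalPoly

variable {s : ℕ}

lemma qParam_one_moebius {a b d : ℕ} (ha : a ≠ 0) (hd : d ≠ 0) (τ : ℂ) :
    qParam 1 (moebius !![(a : ℤ), (b : ℤ); 0, (d : ℤ)] τ) =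
      Complex.exp (2 * Real.pi * Complex.I / (a * d : ℕ)) ^ (a * b) *
        qParam (a * d : ℕ) τ ^ a ^ 2 := by
  simp only [qParam, moebius, ← Complex.exp_nat_mul, ← Complex.exp_add]
  congr 1
  simp only [Matrix.of_apply, Matrix.cons_val', Matrix.cons_val_zero, Matrix.cons_val_fin_one,
    Matrix.cons_val_one, Int.cast_natCast, Int.cast_zero, zero_mul, zero_add, Complex.ofReal_one,
    div_one, Nat.cast_mul, Nat.cast_pow, Complex.ofReal_mul, Complex.ofReal_natCast]
  field_simp
  ring

lemma formalFactor_mem_coeffwise {m : ℕ} (hm : m ≠ 0) {w Q : ℂ} (hw : w ^ s = 1) (hs : 0 < s)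
    {τ : ℍ} (hτ : qParam 1 τ = w * Q ^ m) :
    (formalFactor s m w, C (Q ^ m) * (X - C (j τ))) ∈ coeffwise (seriesGraph ℂ Q) := by
  have w_pow_mul : w ^ (s - 1) * w = 1 := by rw [pow_sub_one_mul hs.ne', hw]
  have hX : (PowerSeries.X ^ m, Q ^ m) ∈ seriesGraph ℂ Q := pow_mem (X_mem_seriesGraph ℂ Q) m
  have hj : ((PowerSeries.rescale w (jSeries.map (Int.castRingHom ℂ))).expand m hm,
      qParam 1 τ * j τ) ∈ seriesGraph ℂ Q := by
    refine (expand_mem_seriesGraph_iff hm).mpr (rescale_mem_seriesGraph w ?_)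
    have h := map_algebraMap_mem_seriesGraph (jSeries_mem_seriesGraph τ)
    rwa [hτ] at h ⊢
  have h_const := mul_mem (C_mem_seriesGraph Q (w ^ (s - 1))) hj
  rw [Prod.mk_mul_mk, Algebra.algebraMap_self_apply, hτ, ← mul_assoc, ← mul_assoc, w_pow_mul,
    one_mul] at h_const
  have h := sub_mem (mul_mem (C_mem_coeffwise hX) X_mem_coeffwise) (C_mem_coeffwise h_const)
  rw [Prod.mk_mul_mk, Prod.mk_sub_mk, ← formalFactor_eq_expand, C_mul, ← mul_sub] at h
  exact h

theorem formalPrincipalPoly_mem_coeffwise (hs : 0 < s) (τ : ℍ) :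
    (formalPrincipalPoly s (Complex.exp (2 * Real.pi * Complex.I / s)),
      C (qParam s τ ^ ∑ t ∈ repTriples s, t.1.1 ^ 2) * principalPoly s τ) ∈
      coeffwise (seriesGraph ℂ (qParam s τ)) := by
  have h : ∀ t ∈ repTriples s,
      (formalFactor s (t.1.1 ^ 2) (Complex.exp (2 * Real.pi * Complex.I / s) ^ (t.1.1 * t.1.2)),
        C (qParam s τ ^ t.1.1 ^ 2) *
          (X - C (j (moebius !![(t.1.1 : ℤ), (t.1.2 : ℤ); 0, (t.2 : ℤ)] τ)))) ∈
        coeffwise (seriesGraph ℂ (qParam s τ)) := by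
    rintro ⟨⟨a, b⟩, d⟩ ht
    obtain rfl := ((mem_repTriples hs).mp ht).1
    have ha : a ≠ 0 := left_ne_zero_of_mul hs.ne'
    have hd : d ≠ 0 := right_ne_zero_of_mul hs.ne'
    obtain ⟨τ', hτ'⟩ := exists_coe_eq_moebius hs (mem_reps_of_mem_repTriples ht) τ
    rw [← hτ']
    refine formalFactor_mem_coeffwise (pow_ne_zero 2 ha) ?_ hs ?_
    · rw [pow_right_comm, (Complex.isPrimitiveRoot_exp _ hs.ne').pow_eq_one, one_pow]
    · rw [hτ', qParam_one_moebius ha hd]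
  have h_prod := prod_mem h
  rw [← prod_mk_prod, Finset.prod_mul_distrib, ← map_prod, Finset.prod_pow_eq_pow_sum] at h_prod
  rwa [principalPoly, prod_reps]

end ExpansionOfPrincipalPoly

section IntegralityOfPrincipalPoly

variable {s : ℕ}

lemma exists_cyclotomic_dvd_coeff_formalPrincipalPoly_sub_C (hs : 0 < s) (k n : ℕ) :
    ∃ m : ℤ, cyclotomic s ℤ ∣
      ((formalPrincipalPoly s (X : ℤ[X])).coeff k).coeff n - C m := by
  have hζ := Complex.isPrimitiveRoot_exp s hs.ne'
  have aeval_coeff (z : ℂ) : aeval z (((formalPrincipalPoly s (X : ℤ[X])).coeff k).coeff n) =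
      ((formalPrincipalPoly s z).coeff k).coeff n := by
    have h := map_formalPrincipalPoly hs (aeval z : ℤ[X] →ₐ[ℤ] ℂ).toRingHom X
    rw [AlgHom.toRingHom_eq_coe, RingHom.coe_coe, aeval_X] at h
    rw [← h, coeff_map, PowerSeries.coeff_map, RingHom.coe_coe]
  refine exists_cyclotomic_dvd_sub_C hs hζ fun z hz => ?_
  have : NeZero s := ⟨hs.ne'⟩
  obtain ⟨u, -, hu, rfl⟩ := hζ.isPrimitiveRoot_iff.mp hz
  rw [aeval_coeff, aeval_coeff, formalPrincipalPoly_pow_of_coprime hs hu hζ.pow_eq_one]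

theorem exists_map_eq_formalPrincipalPoly (hs : 0 < s) :
    ∃ P : ℤ⟦X⟧[X], ∀ {R : Type*} [CommRing R] {z : R}, (cyclotomic s R).IsRoot z →
      P.map (PowerSeries.map (Int.castRingHom R)) = formalPrincipalPoly s z := by
  choose m hm using fun k n => exists_cyclotomic_dvd_coeff_formalPrincipalPoly_sub_C hs k n
  refine ⟨∑ k ∈ Finset.range ((formalPrincipalPoly s (X : ℤ[X])).natDegree + 1),
    monomial k (PowerSeries.mk (m k)), fun {R} _ z hz => ?_⟩
  have h := map_formalPrincipalPoly hs (aeval z : ℤ[X] →ₐ[ℤ] R).toRingHom X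
  rw [AlgHom.toRingHom_eq_coe, RingHom.coe_coe, aeval_X] at h
  have root : aeval z (cyclotomic s ℤ) = 0 := by
    rwa [aeval_def, eval₂_eq_eval_map, map_cyclotomic]
  rw [← h]
  ext k n
  simp only [coeff_map, finsetSum_coeff, coeff_monomial, Finset.sum_ite_eq', Finset.mem_range]
  split_ifs with hk
  · have h_dvd := map_dvd (aeval z) (hm k n)
    rw [root, zero_dvd_iff, map_sub, sub_eq_zero] at h_dvd
    simpa using h_dvd.symm
  · rw [coeff_eq_zero_of_natDegree_lt (by omega)]
    simp only [map_zero]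

end IntegralityOfPrincipalPoly

section ModularPolynomial

variable {s : ℕ}

lemma map_mem_coeffwise_seriesGraph_iff {R S : Type*} [CommRing R] [CommRing S] [Algebra R ℂ]
    [Algebra S ℂ] {φ : R →+* S} (hφ : (algebraMap S ℂ).comp φ = algebraMap R ℂ) {P : R⟦X⟧[X]}
    {v : ℂ[X]} {q : ℂ} : (P.map (PowerSeries.map φ), v) ∈ coeffwise (seriesGraph S q) ↔
      (P, v) ∈ coeffwise (seriesGraph R q) := by
  simp only [mem_coeffwise, coeff_map, map_mem_seriesGraph_iff hφ]

lemma mem_coeffwise_of_map_eq_formalPrincipalPoly (hs : 0 < s) {P : ℤ⟦X⟧[X]}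
    (hP : P.map (PowerSeries.map (Int.castRingHom ℂ)) =
      formalPrincipalPoly s (Complex.exp (2 * Real.pi * Complex.I / s))) (τ : ℍ) :
    (P, C (qParam s τ ^ ∑ t ∈ repTriples s, t.1.1 ^ 2) * principalPoly s τ) ∈
      coeffwise (seriesGraph ℤ (qParam s τ)) :=
  (map_mem_coeffwise_seriesGraph_iff (RingHom.ext_int _ _)).mp
    (hP ▸ formalPrincipalPoly_mem_coeffwise hs τ)

theorem exists_isModularPolynomial (hs : 0 < s) : ∃ F, IsModularPolynomial s F := by
  obtain ⟨P, hP⟩ := exists_map_eq_formalPrincipalPoly hs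
  exact exists_map_eval₂_j_eq_of_mem_coeffwise (algebraMap ℤ ℂ).injective_int hs.ne'
    (c := fun τ => principalPoly s τ) (principalPoly_smul hs)
    (mem_coeffwise_of_map_eq_formalPrincipalPoly hs
      (hP ((Complex.isPrimitiveRoot_exp s hs.ne').isRoot_cyclotomic hs)))

theorem IsModularPolynomial.unique {F G : ℤ[X][X]} (hF : IsModularPolynomial s F)
    (hG : IsModularPolynomial s G) : F = G :=
  eq_of_map_eval₂_j_eq (algebraMap ℤ ℂ).injective_int fun τ => (hF τ).trans (hG τ).symm

end ModularPolynomial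

section KroneckerCongruence

lemma powerSeries_C_dvd_iff {R : Type*} [CommRing R] {a : R} {f : R⟦X⟧} :
    PowerSeries.C a ∣ f ↔ ∀ n, a ∣ f.coeff n := by
  refine ⟨?_, fun h => ?_⟩
  · rintro ⟨g, rfl⟩ n
    exact ⟨g.coeff n, PowerSeries.coeff_C_mul n g a⟩
  · choose g hg using h
    exact ⟨PowerSeries.mk g, by ext n; simp [hg]⟩

lemma C_C_natCast_dvd_iff_map_eq_zero {n : ℕ} {P : ℤ⟦X⟧[X]} :
    C (PowerSeries.C (n : ℤ)) ∣ P ↔ P.map (PowerSeries.map (Int.castRingHom (ZMod n))) = 0 := by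
  rw [C_dvd_iff_dvd_coeff]
  simp only [powerSeries_C_dvd_iff, Polynomial.ext_iff, PowerSeries.ext_iff, coeff_map,
    PowerSeries.coeff_map, coeff_zero, map_zero, Int.coe_castRingHom,
    ZMod.intCast_zmod_eq_zero_iff_dvd]

theorem C_C_dvd_of_C_C_dvd_expansion {R : Type*} [CommRing R] [Algebra R ℂ] {s N : ℕ}
    (hR : Function.Injective (algebraMap R ℂ)) (hs : s ≠ 0) {a : R} (ha : a ≠ 0) {F : R[X][X]}
    {P : R⟦X⟧[X]} (hP : ∀ τ : ℍ, (P, C (qParam s τ ^ N) *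
      F.map (eval₂RingHom (algebraMap R ℂ) (j τ))) ∈ coeffwise (seriesGraph R (qParam s τ)))
    (h_dvd : C (PowerSeries.C a) ∣ P) : C (C a) ∣ F := by
  obtain ⟨D, rfl⟩ := h_dvd
  have ha' : algebraMap R ℂ a ≠ 0 := (map_ne_zero_iff _ hR).mpr ha
  obtain ⟨E, hE⟩ := exists_map_eval₂_j_eq_of_mem_coeffwise hR hs (N := N) (P := D)
    (c := fun τ => C (algebraMap R ℂ a)⁻¹ * F.map (eval₂RingHom (algebraMap R ℂ) (j τ)))
    (fun γ τ => by simp only [j_smul]) fun τ k => by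
      refine mem_seriesGraph_of_C_mul_mem ha' ?_
      convert hP τ k using 2
      · exact (coeff_C_mul D).symm
      · simp only [coeff_C_mul]
        field_simp
  refine ⟨E, eq_of_map_eval₂_j_eq hR fun τ => ?_⟩
  rw [Polynomial.map_mul, hE, map_C, ← mul_assoc, coe_eval₂RingHom, eval₂_C, ← C_mul,
    mul_inv_cancel₀ ha', C_1, one_mul]

variable {p : ℕ}

@[to_additive]
lemma prod_repTriples_prime {M : Type*} [CommMonoid M] (hp : p.Prime) (φ : (ℕ × ℕ) × ℕ → M) :
    ∏ t ∈ repTriples p, φ t = φ ((p, 0), 1) * ∏ b ∈ Finset.range p, φ ((1, b), p) := by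
  have repTriples_eq : repTriples p =
      insert ((p, 0), 1) ((Finset.range p).image fun b => ((1, b), p)) := by
    ext ⟨⟨a, b⟩, d⟩
    simp only [mem_repTriples hp.pos, Finset.mem_insert, Finset.mem_image, Finset.mem_range,
      Prod.mk.injEq]
    constructor
    · rintro ⟨had, hbd, -⟩
      obtain rfl | rfl := (Nat.dvd_prime hp).mp ⟨d, had.symm⟩
      · obtain rfl : d = p := (one_mul d).symm.trans had
        exact Or.inr ⟨b, hbd, ⟨rfl, rfl⟩, rfl⟩
      · obtain rfl : d = 1 := Nat.eq_of_mul_eq_mul_left hp.pos (had.trans (mul_one a).symm)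
        exact Or.inl ⟨⟨rfl, Nat.lt_one_iff.mp hbd⟩, rfl⟩
    · rintro (⟨⟨rfl, rfl⟩, rfl⟩ | ⟨b, hb, ⟨rfl, rfl⟩, rfl⟩) <;> simp [*]
  rw [repTriples_eq, Finset.prod_insert, Finset.prod_image]
  · simp
  · simp [hp.ne_one.symm]

lemma expand_eq_pow [Fact p.Prime] (hp : p ≠ 0) (f : (ZMod p)⟦X⟧) : f.expand p hp = f ^ p := by
  rw [← MvPowerSeries.map_frobenius_expand p hp (f := f), ZMod.frobenius_zmod]
  exact (congrFun PowerSeries.map_id _).symm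

lemma formalPrincipalPoly_zmod_one (hp : p.Prime) : formalPrincipalPoly p (1 : ZMod p) =
    (C (PowerSeries.X ^ p ^ 2) * X -
        C ((jSeries.map (Int.castRingHom (ZMod p))).expand (p ^ 2) (pow_ne_zero 2 hp.ne_zero))) *
      (C PowerSeries.X * X - C (jSeries.map (Int.castRingHom (ZMod p)))) ^ p := by
  rw [formalPrincipalPoly, prod_repTriples_prime hp]
  simp [formalFactor_eq_expand (pow_ne_zero 2 hp.ne_zero), formalFactor_eq_expand one_ne_zero]

/-- The expansion of `(X ^ p - j) * (X - j ^ p)` in powers of `Q = q ^ (1 / p)`, multiplied by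
`Q ^ (p ^ 2 + p)` to clear denominators. -/
def kroneckerSeries (hp : p ≠ 0) : ℤ⟦X⟧[X] :=
  (C (PowerSeries.X ^ p) * X ^ p - C (jSeries.expand p hp)) *
    (C (PowerSeries.X ^ p ^ 2) * X - C (jSeries.expand p hp ^ p))

lemma kroneckerSeries_mem_coeffwise (hp : p ≠ 0) (τ : ℍ) :
    (kroneckerSeries hp, C (qParam p τ ^ (p ^ 2 + p)) * ((X ^ p - C (j τ)) * (X - C (j τ) ^ p))) ∈
      coeffwise (seriesGraph ℤ (qParam p τ)) := by
  set Q := qParam p τ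
  have hX (m : ℕ) : (PowerSeries.X ^ m, Q ^ m) ∈ seriesGraph ℤ Q :=
    pow_mem (X_mem_seriesGraph ℤ Q) m
  have hj : (jSeries.expand p hp, Q ^ p * j τ) ∈ seriesGraph ℤ Q := by
    rw [expand_mem_seriesGraph_iff, qParam_pow_natCast hp]
    exact jSeries_mem_seriesGraph τ
  have hj_pow : (jSeries.expand p hp ^ p, (Q ^ p * j τ) ^ p) ∈ seriesGraph ℤ Q := pow_mem hj p
  have hX_pow : (X ^ p, X ^ p) ∈ coeffwise (seriesGraph ℤ Q) := pow_mem X_mem_coeffwise p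
  have h := mul_mem
    (sub_mem (mul_mem (C_mem_coeffwise (hX p)) hX_pow) (C_mem_coeffwise hj))
    (sub_mem (mul_mem (C_mem_coeffwise (hX (p ^ 2))) X_mem_coeffwise) (C_mem_coeffwise hj_pow))
  simp only [Prod.mk_mul_mk, Prod.mk_sub_mk] at h
  have clear_denominators : C (Q ^ (p ^ 2 + p)) * ((X ^ p - C (j τ)) * (X - C (j τ) ^ p)) =
      (C (Q ^ p) * X ^ p - C (Q ^ p * j τ)) * (C (Q ^ p ^ 2) * X - C ((Q ^ p * j τ) ^ p)) := by
    simp only [map_mul, map_pow]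
    ring
  rw [clear_denominators]
  exact h

/-- Since `f (X ^ p) = f ^ p` over `ZMod p`, both sides are
`(X ^ (p ^ 2) * Y - jSeries ^ (p ^ 2)) * (X * Y - jSeries) ^ p`. -/
lemma map_kroneckerSeries_zmod (hp : p.Prime) :
    (kroneckerSeries hp.ne_zero).map (PowerSeries.map (Int.castRingHom (ZMod p))) =
      formalPrincipalPoly p (1 : ZMod p) := by
  have : Fact p.Prime := ⟨hp⟩
  have : CharP (ZMod p)⟦X⟧[X] p :=
    charP_of_injective_ringHom (f := (C : (ZMod p)⟦X⟧ →+* _).comp PowerSeries.C)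
      (C_injective.comp PowerSeries.C_injective) p
  have expand_sq (f : (ZMod p)⟦X⟧) :
      f.expand (p ^ 2) (pow_ne_zero 2 hp.ne_zero) = (f ^ p) ^ p := by
    simp only [pow_two, PowerSeries.expand_mul _ hp.ne_zero _ hp.ne_zero, expand_eq_pow]
  rw [formalPrincipalPoly_zmod_one hp, expand_sq, sub_pow_char, kroneckerSeries]
  simp only [Polynomial.map_mul, Polynomial.map_sub, Polynomial.map_pow, map_C, map_X, map_pow,
    PowerSeries.map_X, PowerSeries.map_expand, expand_eq_pow, mul_pow]
  ring

/-- Specialising the root of unity to `1` in `ZMod p` is legitimate because `Φ_p(1) = p`. -/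
theorem IsModularPolynomial.natCast_dvd_sub {F : ℤ[X][X]} (hp : p.Prime)
    (hF : IsModularPolynomial p F) : (p : ℤ[X][X]) ∣ F - (X ^ p - C X) * (X - C X ^ p) := by
  have : Fact p.Prime := ⟨hp⟩
  obtain ⟨P, hP⟩ := exists_map_eq_formalPrincipalPoly hp.pos
  have isRoot_one : (cyclotomic p (ZMod p)).IsRoot 1 := by
    rw [IsRoot, eval_one_cyclotomic_prime, CharP.cast_eq_zero]
  have h_dvd : C (PowerSeries.C (p : ℤ)) ∣ P - kroneckerSeries hp.ne_zero := by
    rw [C_C_natCast_dvd_iff_map_eq_zero, Polynomial.map_sub, map_kroneckerSeries_zmod hp,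
      hP isRoot_one, sub_self]
  have h_mem (τ : ℍ) : (P - kroneckerSeries hp.ne_zero, C (qParam p τ ^ (p ^ 2 + p)) *
      (F - (X ^ p - C X) * (X - C X ^ p)).map (eval₂RingHom (algebraMap ℤ ℂ) (j τ))) ∈
      coeffwise (seriesGraph ℤ (qParam p τ)) := by
    have h := sub_mem (mem_coeffwise_of_map_eq_formalPrincipalPoly hp.pos
      (hP ((Complex.isPrimitiveRoot_exp p hp.ne_zero).isRoot_cyclotomic hp.pos)) τ)
      (kroneckerSeries_mem_coeffwise hp.ne_zero τ)
    rw [sum_repTriples_prime hp, Prod.mk_sub_mk, ← hF τ] at h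
    simpa [mul_sub] using h
  exact_mod_cast C_C_dvd_of_C_C_dvd_expansion (algebraMap ℤ ℂ).injective_int hp.ne_zero
    (Nat.cast_ne_zero.mpr hp.ne_zero) h_mem h_dvd

end KroneckerCongruence

end

end ModularTransformation

theorem mainTheorem3 :
    (∀ s : ℕ, 0 < s → ∃! F : ℤ[X][X], ModularTransformation.IsModularPolynomial s F) ∧
    (∀ p : ℕ, p.Prime → ∀ F : ℤ[X][X], ModularTransformation.IsModularPolynomial p F →
      (p : ℤ[X][X]) ∣ F - (X ^ p - C X) * (X - C X ^ p)) := by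
  refine ⟨fun s hs => ?_, fun p hp F hF => hF.natCast_dvd_sub hp⟩
  obtain ⟨F, hF⟩ := ModularTransformation.exists_isModularPolynomial hs
  exact ⟨F, hF, fun G hG => hG.unique hF⟩
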